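/- Let $G$ be a compact Lie group. Consider finite oriented two-complexes $\Sigma$ (vertices, oriented edges, oriented polygonal faces) PL embedded in $S^3\times[0,1]$, with $\Sigma\cap(S^3\times\{0\})=\Gamma$ and $\Sigma\cap(S^3\times\{1\})=\Gamma'$ graphs near which $\Sigma$ is a cylinder. A *spin foam* $(\Sigma,\tilde\rho,\tilde\iota)$ labels each face $f$ by a finite-dimensional representation $\tilde\rho_f$ of $G$ and each edge $e$ not in $\Gamma\cup\Gamma'$ by an intertwiner $\tilde\iota_e:\bigotimes_{f:\,e\in\partial f}\tilde\rho_f\to\bigotimes_{f':\,\bar e\in\partial f'}\tilde\rho_{f'}$. A *topspin foam* $\Psi=(\Sigma,\tilde\rho,\tilde\iota,\tilde\sigma)$ carries moreover a representation $\tilde\sigma:\pi_1((S^3\times[0,1])\smallsetminus\Sigma)\to S_n$, for some $n\ge 1$, whose branched cover $W$ of $S^3\times[0,1]$, branched along $\Sigma$, is a PL four-manifold. Spin foams and two-complexes are considered up to PL ambient isotopy of $S^3\times[0,1]$. Write $\Psi\sim\Psi'$ when $(\Sigma,\tilde\sigma)$ and $(\Sigma',\tilde\sigma')$ determine the same PL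 four-manifold. Fix a class of admissible labelings and an amplitude $$\mathbb A(\Psi)=\omega(\Sigma)\,\mathbb A_{\rm comb}(\Psi),\qquad \mathbb A_{\rm comb}(\Psi)=\prod_f\mathbb A_f(\tilde\rho_f)\prod_e\mathbb A_e(\tilde\rho_{F(e)},\tilde\iota_e)\prod_v\mathbb A_v(\tilde\rho_{F(v)},\tilde\iota_{E(v)}),$$ where $F(\cdot)$ and $E(\cdot)$ denote the adjacent faces and (non-boundary) edges, $\omega$ is an ambient isotopy invariant, and both admissibility and $\mathbb A_{\rm comb}$ depend only on the combinatorial labeled complex. Let $\mathcal C_\Psi$ be the set of isotopy classes of admissible spin foams $(\Sigma',\tilde\rho',\tilde\iota')$ that admit a $\tilde\sigma'$ with $(\Sigma',\tilde\rho',\tilde\iota',\tilde\sigma')\sim\Psi$ (so equivalent topspin foams that differ only in $\tilde\sigma'$ are identified). The time evolution $\sigma_t(f)(\Psi_1,\Psi_2)=(\mathbb A(\Psi_1)/\mathbb A(\Psi_2))^{it}f(\Psi_1,\Psi_2)$ on finitely supported functions on pairs of equivalent elements is generated, in the representation $(\pi(f)\xi)(\Psi_1)=\sum_{\Psi_2}f(\Psi_1,\Psi_2)\xi(\Psi_2)$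 on $\ell^2(\mathcal C_\Psi)$, by $(\mathbb H\xi)(\Psi')=\log\mathbb A(\Psi')\,\xi(\Psi')$. Suppose: 1. All values of $\omega$ lie in $\{\alpha(n)\}_{n\in\mathbb N}\subset\mathbb R_{>0}$ with $\alpha(n)\ge B e^{cn}$ for large $n$, for some $B,c>0$; and for some $\kappa>0$ and $B'$, for every combinatorial type $\Sigma_0$ and every $n$, the number of isotopy classes of embedded $\Sigma\simeq\Sigma_0$ with $\omega(\Sigma)=\alpha(n)$ is finite and at most $B'e^{\kappa n}$. 2. All values of $\mathbb A_{\rm comb}$ on admissible labelings of two-complexes embeddable as above lie in $\{A_m\}_{m\in\mathbb N}\subset\mathbb R_{>0}$ with $A_m\ge B e^{cm}$ for large $m$, for some $B,c>0$; and for some $\lambda>0$ and $B'$, for every $m$, the number of $(\Sigma,\tilde\rho,\tilde\iota)$ with $\mathbb A_{\rm comb}=A_m$ is finite and at most $B'e^{\lambda m}$, where $\Sigma$ runs over representatives of the combinatorial types of embedded two-complexes and $(\tilde\rho,\tilde\iota)$ over the admissible labelings of that representative. Then there is $\beta_0>0$ such that, for every topspin foam $\Psi$ and every $\beta>\beta_0$,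 the operator $e^{-\beta\mathbb H}$ on $\ell^2(\mathcal C_\Psi)$ is trace class: $\mathrm{Tr}(e^{-\beta\mathbb H})<\infty$. -/

import Mathlib

open Filter Topology
open scoped TensorProduct ENNReal InnerProductSpace

universe u

noncomputable section

/-! ### Piecewise linear topology -/

namespace PL

variable {E F : Type} [AddCommGroup E] [Module ℝ E] [AddCommGroup F] [Module ℝ F]

/-- A compact polyhedron: a finite union of convex hulls of finite sets. -/
def IsPolyhedron (P : Set E) : Prop :=
  ∃ C : Set (Set E), C.Finite ∧ (∀ t ∈ C, t.Finite) ∧ P = ⋃ t ∈ C, convexHull ℝ t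

/-- `f` is a PL map on the compact polyhedron `P`: its graph over `P` is a compact polyhedron. -/
def IsPLOn (f : E → F) (P : Set E) : Prop :=
  IsPolyhedron ((fun x => (x, f x)) '' P)

/-- `f` restricts to a PL homeomorphism from the compact polyhedron `P` onto `Q`. -/
def IsPLHomeoOn (f : E → F) (P : Set E) (Q : Set F) : Prop :=
  IsPLOn f P ∧ Set.BijOn f P Q

/-- `W` is a compact PL four-manifold, possibly with boundary: a compact polyhedron each of whose
points has a polyhedral neighbourhood in `W` that is PL homeomorphic to the four-cube. -/
def IsFourManifold {N : ℕ} (W : Set (Fin N → ℝ)) : Prop :=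
  IsPolyhedron W ∧ ∀ w ∈ W, ∃ B ⊆ W, B ∈ 𝓝[W] w ∧
    ∃ f : (Fin N → ℝ) → (Fin 4 → ℝ), IsPLHomeoOn f B (Set.Icc 0 1)

end PL

/-- The affine space in which `S³ × [0,1]` is realized. -/
abbrev Ambient : Type := (Fin 4 → ℝ) × ℝ

/-- `S³ × [0,1]`, where `S³` is the PL three-sphere, realized as the boundary of the four-cube
`[-1,1]⁴`, which is the unit sphere of the sup norm. -/
def Cyl : Set Ambient := {p | ‖p.1‖ = 1 ∧ p.2 ∈ Set.Icc (0 : ℝ) 1}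

/-! ### Combinatorial oriented two-complexes -/

/-- `b` comes directly after `a` along the oriented polygon `f`. -/
def Follows {V : Type} (f : Cycle V) (a b : V) : Prop :=
  ∃ l : List V, f = ((a :: b :: l : List V) : Cycle V)

/-- A finite oriented combinatorial two-complex with a marked incoming boundary graph (`bot`) and
a marked outgoing boundary graph (`top`). The vertices are `Fin n`; an oriented edge is the pair
of its endpoints; an oriented face is a polygon (a triangle, if the complex is simplicial), given
as the cyclically ordered set of its vertices. -/
structure TwoComplex where
  n : ℕ
  edges : Finset (Fin n × Fin n)
  faces : Finset (Cycle (Fin n))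
  edge_ne : ∀ e ∈ edges, e.1 ≠ e.2
  edge_or : ∀ e ∈ edges, (e.2, e.1) ∉ edges
  face_len : ∀ f ∈ faces, 3 ≤ f.length
  face_nodup : ∀ f ∈ faces, f.Nodup
  face_or : ∀ f ∈ faces, f.reverse ∉ faces
  face_edges : ∀ f ∈ faces, ∀ a b, Follows f a b → (a, b) ∈ edges ∨ (b, a) ∈ edges
  botV : Finset (Fin n)
  topV : Finset (Fin n)
  botE : Finset (Fin n × Fin n)
  topE : Finset (Fin n × Fin n)
  botE_sub : ∀ e ∈ botE, e ∈ edges ∧ e.1 ∈ botV ∧ e.2 ∈ botV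
  topE_sub : ∀ e ∈ topE, e ∈ edges ∧ e.1 ∈ topV ∧ e.2 ∈ topV

namespace TwoComplex

/-- The edges of `K`. -/
abbrev Edge (K : TwoComplex) : Type := {e : Fin K.n × Fin K.n // e ∈ K.edges}

/-- The faces of `K`. -/
abbrev Face (K : TwoComplex) : Type := {f : Cycle (Fin K.n) // f ∈ K.faces}

/-- The edges of `K` that do not lie in the boundary graphs. -/
abbrev InnerEdge (K : TwoComplex) : Type := {e : K.Edge // e.1 ∉ K.botE ∧ e.1 ∉ K.topE}

open Classical in
/-- The coefficient of the oriented edge `e` in the boundary `∂f` of the oriented face `f`. -/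
def inc (K : TwoComplex) (e : K.Edge) (f : K.Face) : SignType :=
  if Follows f.1 e.1.1 e.1.2 then 1 else if Follows f.1 e.1.2 e.1.1 then -1 else 0

/-- Combinatorial equivalence of oriented two-complexes with boundary graphs. -/
structure Iso (K K' : TwoComplex) where
  toEquiv : Fin K.n ≃ Fin K'.n
  edges_iff : ∀ a b, (a, b) ∈ K.edges ↔ (toEquiv a, toEquiv b) ∈ K'.edges
  faces_iff : ∀ f, f ∈ K.faces ↔ f.map toEquiv ∈ K'.faces
  botV_iff : ∀ a, a ∈ K.botV ↔ toEquiv a ∈ K'.botV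
  topV_iff : ∀ a, a ∈ K.topV ↔ toEquiv a ∈ K'.topV
  botE_iff : ∀ a b, (a, b) ∈ K.botE ↔ (toEquiv a, toEquiv b) ∈ K'.botE
  topE_iff : ∀ a b, (a, b) ∈ K.topE ↔ (toEquiv a, toEquiv b) ∈ K'.topE

end TwoComplex

theorem Cycle.map_map_aux {V V' V'' : Type} (g : V' → V'') (h : V → V') (f : Cycle V) :
    (f.map h).map g = f.map (g ∘ h) := by
  induction f using Quot.inductionOn with
  | h l => exact congrArg (fun l : List V'' => (l : Cycle V'')) (List.map_map ..)

theorem Cycle.map_id_aux {V : Type} (f : Cycle V) : f.map id = f := by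
  induction f using Quot.inductionOn with
  | h l => exact congrArg (fun l : List V => (l : Cycle V)) (List.map_id l)

theorem Follows.mem {V : Type} {f : Cycle V} {a b : V} (h : Follows f a b) : a ∈ f ∧ b ∈ f := by
  obtain ⟨l, rfl⟩ := h
  simp

theorem Follows.map_iff {V V' : Type} (φ : V ≃ V') (f : Cycle V) (a b : V) :
    Follows (f.map φ) (φ a) (φ b) ↔ Follows f a b := by
  have key : ∀ {V V' : Type} (φ : V → V') (f : Cycle V) (a b : V),
      Follows f a b → Follows (f.map φ) (φ a) (φ b) := by
    rintro V V' φ f a b ⟨l, rfl⟩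
    exact ⟨l.map φ, rfl⟩
  refine ⟨fun h => ?_, key φ f a b⟩
  have := key φ.symm _ _ _ h
  rwa [Cycle.map_map_aux, Equiv.symm_comp_self, Cycle.map_id_aux, Equiv.symm_apply_apply,
    Equiv.symm_apply_apply] at this

namespace TwoComplex

/-- The identity equivalence. -/
def Iso.refl (K : TwoComplex) : Iso K K where
  toEquiv := Equiv.refl _
  edges_iff _ _ := Iff.rfl
  faces_iff f := by simp [Cycle.map_id_aux]
  botV_iff _ := Iff.rfl
  topV_iff _ := Iff.rfl
  botE_iff _ _ := Iff.rfl
  topE_iff _ _ := Iff.rfl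

/-- The inverse equivalence. -/
def Iso.symm {K K' : TwoComplex} (φ : Iso K K') : Iso K' K where
  toEquiv := φ.toEquiv.symm
  edges_iff a b := by simp [φ.edges_iff]
  faces_iff f := by
    rw [φ.faces_iff, Cycle.map_map_aux, Equiv.self_comp_symm, Cycle.map_id_aux]
  botV_iff a := by simp [φ.botV_iff]
  topV_iff a := by simp [φ.topV_iff]
  botE_iff a b := by simp [φ.botE_iff]
  topE_iff a b := by simp [φ.topE_iff]

/-- The composite equivalence. -/
def Iso.trans {K K' K'' : TwoComplex} (φ : Iso K K') (ψ : Iso K' K'') : Iso K K'' where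
  toEquiv := φ.toEquiv.trans ψ.toEquiv
  edges_iff a b := by rw [φ.edges_iff, ψ.edges_iff]; rfl
  faces_iff f := by rw [φ.faces_iff, ψ.faces_iff, Cycle.map_map_aux, Equiv.coe_trans]
  botV_iff a := by rw [φ.botV_iff, ψ.botV_iff]; rfl
  topV_iff a := by rw [φ.topV_iff, ψ.topV_iff]; rfl
  botE_iff a b := by rw [φ.botE_iff, ψ.botE_iff]; rfl
  topE_iff a b := by rw [φ.topE_iff, ψ.topE_iff]; rfl

/-- The map on edges of a combinatorial equivalence. -/
def Iso.edge {K K' : TwoComplex} (φ : Iso K K') (e : K.Edge) : K'.Edge :=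
  ⟨(φ.toEquiv e.1.1, φ.toEquiv e.1.2), (φ.edges_iff _ _).1 e.2⟩

/-- The map on faces of a combinatorial equivalence. -/
def Iso.face {K K' : TwoComplex} (φ : Iso K K') (f : K.Face) : K'.Face :=
  ⟨f.1.map φ.toEquiv, (φ.faces_iff _).1 f.2⟩

end TwoComplex

/-! ### Labels: representations and intertwiners -/

section Labels

variable (G : Type u) [Group G] [TopologicalSpace G]

/-- A finite-dimensional continuous complex representation of `G`. -/
structure FinRep where
  dim : ℕ
  hom : Representation ℂ G (Fin dim → ℂ)
  cont : ∀ v, Continuous fun g => hom g v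

variable {G}

/-- The underlying vector space of a representation. -/
abbrev FinRep.V (ρ : FinRep G) : Type := Fin ρ.dim → ℂ

/-- The action of `g` on a tensor product of representations. -/
def tensorAct {J : Type} (ρ : J → FinRep G) (g : G) :
    (⨂[ℂ] j, (ρ j).V) →ₗ[ℂ] (⨂[ℂ] j, (ρ j).V) :=
  PiTensorProduct.map fun j => (ρ j).hom g

/-- Intertwining operators between two tensor products of representations. -/
def Intertwiner {J J' : Type} (ρ : J → FinRep G) (ρ' : J' → FinRep G) : Type :=
  {T : (⨂[ℂ] j, (ρ j).V) →ₗ[ℂ] (⨂[ℂ] j, (ρ' j).V) //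
    ∀ g, T ∘ₗ tensorAct ρ g = tensorAct ρ' g ∘ₗ T}

/-- Re-indexing the tensor factors of an intertwiner. -/
def Intertwiner.reindex {J J' J₀ J₀' : Type} {ρ : J → FinRep G} {ρ' : J' → FinRep G}
    (T : Intertwiner ρ ρ') (a : J₀ ≃ J) (b : J₀' ≃ J') :
    Intertwiner (fun j => ρ (a j)) (fun j => ρ' (b j)) :=
  ⟨(PiTensorProduct.reindex ℂ (fun j => (ρ' j).V) b.symm).toLinearMap ∘ₗ T.1 ∘ₗ
      (PiTensorProduct.reindex ℂ (fun j => (ρ j).V) a.symm).symm.toLinearMap, by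
    intro g
    have h1 := PiTensorProduct.map_comp_reindex_symm (R := ℂ) (fun j => (ρ j).hom g) a.symm
    have h2 := PiTensorProduct.map_comp_reindex_eq (R := ℂ) (fun j => (ρ' j).hom g) b.symm
    have h3 := T.2 g
    ext x
    have h1' := fun y => DFunLike.congr_fun h1 y
    have h2' := fun y => DFunLike.congr_fun h2 y
    have h3' := fun y => DFunLike.congr_fun h3 y
    simp only [LinearMap.comp_apply, LinearEquiv.coe_coe] at h1' h2' h3'
    simp only [LinearMap.compMultilinearMap_apply, LinearMap.comp_apply, LinearEquiv.coe_coe]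
    refine Eq.trans ?_ (h2' _).symm
    refine congrArg _ ?_
    refine Eq.trans ?_ (h3' _)
    refine congrArg _ ?_
    exact (h1' _).symm⟩

/-- Faces, edges, and the coefficients of edges in the boundaries of faces. -/
structure Incidence where
  F : Type
  E : Type
  inc : E → F → SignType

/-- A labeling of each face by a representation `ρ_f`, and of each edge by an intertwiner
`ι_e : ⨂_{f : e ∈ ∂f} ρ_f → ⨂_{f' : ē ∈ ∂f'} ρ_{f'}`. -/
structure Labeling (G : Type u) [Group G] [TopologicalSpace G] (I : Incidence) where
  ρ : I.F → FinRep G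
  ι : ∀ e : I.E, Intertwiner (fun f : {f : I.F // I.inc e f = 1} => ρ f)
    (fun f : {f : I.F // I.inc e f = -1} => ρ f)

/-- A map of incidence data that preserves the set of faces around each edge. -/
structure IncHom (I J : Incidence) where
  onF : I.F → J.F
  onE : I.E → J.E
  bij : ∀ e s, s ≠ 0 → Set.BijOn onF {f | I.inc e f = s} {f | J.inc (onE e) f = s}

/-- The bijection between the faces around an edge and around its image. -/
def IncHom.around {I J : Incidence} (m : IncHom I J) (e : I.E) (s : SignType) (hs : s ≠ 0) :
    {f : I.F // I.inc e f = s} ≃ {f : J.F // J.inc (m.onE e) f = s} :=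
  Equiv.ofBijective (fun f => ⟨m.onF f.1, (m.bij e s hs).mapsTo f.2⟩)
    ⟨fun f f' h => Subtype.ext ((m.bij e s hs).injOn f.2 f'.2 (congrArg Subtype.val h)),
      fun f => by
        obtain ⟨f', h, h'⟩ := (m.bij e s hs).surjOn f.2
        exact ⟨⟨f', h⟩, Subtype.ext h'⟩⟩

/-- The labeling of `I` induced by a labeling of `J`. -/
def Labeling.pull {I J : Incidence} (L : Labeling G J) (m : IncHom I J) : Labeling G I where
  ρ f := L.ρ (m.onF f)
  ι e := (L.ι (m.onE e)).reindex (m.around e 1 (by decide)) (m.around e (-1) (by decide))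

/-- Some of the faces and edges. -/
def Incidence.sub (I : Incidence) (S : Set I.F) (T : Set I.E) : Incidence :=
  ⟨S, T, fun e f => I.inc e.1 f.1⟩

/-- The inclusion of a part that contains, with each of its edges, all faces around it. -/
def Incidence.subHom (I : Incidence) (S : Set I.F) (T : Set I.E)
    (h : ∀ e ∈ T, ∀ f, I.inc e f ≠ 0 → f ∈ S) : IncHom (I.sub S T) I where
  onF f := f.1
  onE e := e.1
  bij e s hs := by
    refine ⟨fun f hf => hf, fun f _ f' _ hff => Subtype.ext hff, fun f hf => ?_⟩
    have hf' : I.inc e.1 f = s := hf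
    exact ⟨⟨f, h e.1 e.2 f (by rw [hf']; exact hs)⟩, hf', rfl⟩

namespace TwoComplex

/-- The faces and the non-boundary edges of `K`: only the latter carry intertwiners. -/
def incidence (K : TwoComplex) : Incidence :=
  ⟨K.Face, K.InnerEdge, fun e f => K.inc e.1 f⟩

/-- The labels seen by an edge `e`: the faces `F(e)` around `e`, and `e` itself (if it is not a
boundary edge). -/
def edgeStar (K : TwoComplex) (e : K.Edge) : Incidence :=
  K.incidence.sub {f | K.inc e f ≠ 0} {e' | e'.1 = e}

/-- The labels seen by a vertex `v`: the faces `F(v)` and the non-boundary edges `E(v)` adjacent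
to `v`. -/
def vertexStar (K : TwoComplex) (v : Fin K.n) : Incidence :=
  K.incidence.sub {f | v ∈ f.1} {e | v = e.1.1.1 ∨ v = e.1.1.2}

/-- The inclusion of the star of an edge. -/
def edgeStarHom (K : TwoComplex) (e : K.Edge) : IncHom (K.edgeStar e) K.incidence :=
  K.incidence.subHom _ _ (by rintro e' rfl f hf; exact hf)

theorem mem_of_inc_ne_zero (K : TwoComplex) (e : K.Edge) (f : K.Face) (h : K.inc e f ≠ 0) :
    e.1.1 ∈ f.1 ∧ e.1.2 ∈ f.1 := by
  unfold inc at h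
  split_ifs at h with h1 h2
  · exact h1.mem
  · exact h2.mem.symm
  · exact absurd rfl h

/-- The inclusion of the star of a vertex. -/
def vertexStarHom (K : TwoComplex) (v : Fin K.n) : IncHom (K.vertexStar v) K.incidence :=
  K.incidence.subHom _ _ (by
    rintro e he f hf
    have := K.mem_of_inc_ne_zero e.1 f hf
    rcases he with rfl | rfl
    exacts [this.1, this.2])

theorem Iso.inc_eq {K K' : TwoComplex} (φ : Iso K K') (e : K.Edge) (f : K.Face) :
    K'.inc (φ.edge e) (φ.face f) = K.inc e f := by
  have h1 := Follows.map_iff φ.toEquiv f.1 e.1.1 e.1.2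
  have h2 := Follows.map_iff φ.toEquiv f.1 e.1.2 e.1.1
  classical
  exact if_congr h1 rfl (if_congr h2 rfl rfl)

/-- The map of incidence data of a combinatorial equivalence. -/
def Iso.hom {K K' : TwoComplex} (φ : Iso K K') : IncHom K.incidence K'.incidence where
  onF := φ.face
  onE e := ⟨φ.edge e.1, fun h => e.2.1 ((φ.botE_iff _ _).2 h),
    fun h => e.2.2 ((φ.topE_iff _ _).2 h)⟩
  bij e s hs := by
    refine ⟨fun f hf => (φ.inc_eq e.1 f).trans hf, fun f _ f' _ h => ?_, fun f hf => ?_⟩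
    · have h' := congrArg (fun g : K'.Face => g.1.map φ.toEquiv.symm) h
      simp only [Iso.face, Cycle.map_map_aux, Equiv.symm_comp_self, Cycle.map_id_aux] at h'
      exact Subtype.ext h'
    · have hfe : φ.face (φ.symm.face f) = f := Subtype.ext (by
        simp only [Iso.face, Iso.symm, Cycle.map_map_aux, Equiv.self_comp_symm,
          Cycle.map_id_aux])
      refine ⟨φ.symm.face f, ?_, hfe⟩
      have := φ.inc_eq e.1 (φ.symm.face f)
      rw [hfe] at this
      exact this.symm.trans hf

end TwoComplex

end Labels

/-! ### Embedded two-complexes -/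

/-- The cells of a two-complex. -/
inductive TwoComplex.Cell (K : TwoComplex) : Type
  | vertex (v : Fin K.n)
  | edge (e : K.Edge)
  | face (f : K.Face)

/-- The image of a cell under a combinatorial equivalence. -/
def TwoComplex.Iso.cell {K K' : TwoComplex} (φ : TwoComplex.Iso K K') : K.Cell → K'.Cell
  | .vertex v => .vertex (φ.toEquiv v)
  | .edge e => .edge (φ.edge e)
  | .face f => .face (φ.face f)

/-- An oriented two-complex `Σ ⊂ S³ × [0,1]`: a two-complex `K`, together with its closed cells,
which are points, PL arcs and PL discs with disjoint interiors and the prescribed boundaries; the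
boundary graphs are `Σ ∩ (S³ × {0})` and `Σ ∩ (S³ × {1})`, and near them `Σ` is a cylinder, with
one edge running vertically from each boundary vertex. -/
structure EmbComplex where
  K : TwoComplex
  pt : Fin K.n → Ambient
  arc : K.Edge → Set Ambient
  disc : K.Face → Set Ambient
  pt_mem : ∀ v, pt v ∈ Cyl
  arc_sub : ∀ e, arc e ⊆ Cyl
  disc_sub : ∀ f, disc f ⊆ Cyl
  arc_pl : ∀ e, ∃ g : ℝ → Ambient, PL.IsPLHomeoOn g (Set.Icc 0 1) (arc e) ∧
    g 0 = pt e.1.1 ∧ g 1 = pt e.1.2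
  disc_pl : ∀ f, ∃ g : ℝ × ℝ → Ambient, PL.IsPLHomeoOn g (Set.Icc 0 1) (disc f) ∧
    g '' frontier (Set.Icc 0 1) = ⋃ e : {e : K.Edge // K.inc e f ≠ 0}, arc e
  disj : Pairwise fun c c' : K.Cell =>
    let interior : K.Cell → Set Ambient := fun
      | .vertex v => {pt v}
      | .edge e => arc e \ {pt e.1.1, pt e.1.2}
      | .face f => disc f \ ⋃ e : {e : K.Edge // K.inc e f ≠ 0}, arc e
    Disjoint (interior c) (interior c')
  bot_eq : (Set.range pt ∪ (⋃ e, arc e) ∪ ⋃ f, disc f) ∩ {p | p.2 = 0} =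
    (⋃ v ∈ K.botV, {pt v}) ∪ ⋃ e : {e : K.Edge // e.1 ∈ K.botE}, arc e
  top_eq : (Set.range pt ∪ (⋃ e, arc e) ∪ ⋃ f, disc f) ∩ {p | p.2 = 1} =
    (⋃ v ∈ K.topV, {pt v}) ∪ ⋃ e : {e : K.Edge // e.1 ∈ K.topE}, arc e
  collar : ∃ ε > 0, ε < 1 / 2 ∧ ∀ x : Fin 4 → ℝ, ∀ s ∈ Set.Ico (0 : ℝ) ε,
    ((x, s) ∈ (Set.range pt ∪ (⋃ e, arc e) ∪ ⋃ f, disc f) ↔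
      (x, (0 : ℝ)) ∈ (Set.range pt ∪ (⋃ e, arc e) ∪ ⋃ f, disc f)) ∧
    ((x, 1 - s) ∈ (Set.range pt ∪ (⋃ e, arc e) ∪ ⋃ f, disc f) ↔
      (x, (1 : ℝ)) ∈ (Set.range pt ∪ (⋃ e, arc e) ∪ ⋃ f, disc f))
  bot_vert : ∀ v ∈ K.botV, ∃ e : K.Edge, (v = e.1.1 ∨ v = e.1.2) ∧
    ∃ ε > 0, ∀ s ∈ Set.Icc (0 : ℝ) ε, ((pt v).1, s) ∈ arc e
  top_vert : ∀ v ∈ K.topV, ∃ e : K.Edge, (v = e.1.1 ∨ v = e.1.2) ∧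
    ∃ ε > 0, ∀ s ∈ Set.Icc (0 : ℝ) ε, ((pt v).1, 1 - s) ∈ arc e

namespace EmbComplex

/-- The closed cells of an embedded two-complex. -/
def closedCell (S : EmbComplex) : S.K.Cell → Set Ambient
  | .vertex v => {S.pt v}
  | .edge e => S.arc e
  | .face f => S.disc f

/-- The underlying subset of `S³ × [0,1]`. -/
def carrier (S : EmbComplex) : Set Ambient := ⋃ c, S.closedCell c

/-- There is a PL ambient isotopy of `S³ × [0,1]` that carries the cells of `S` to those of `S'`
as the combinatorial equivalence `φ` does. -/
def IsotopicVia (S S' : EmbComplex) (φ : TwoComplex.Iso S.K S'.K) : Prop :=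
  ∃ h : ℝ × Ambient → Ambient, PL.IsPLOn h (Set.Icc 0 1 ×ˢ Cyl) ∧
    (∀ t ∈ Set.Icc (0 : ℝ) 1, Set.BijOn (fun x => h (t, x)) Cyl Cyl) ∧
    (∀ x ∈ Cyl, h (0, x) = x) ∧
    ∀ c, (fun x => h (1, x)) '' S.closedCell c = S'.closedCell (φ.cell c)

/-- Ambient isotopy of embedded two-complexes. -/
def Isotopic (S S' : EmbComplex) : Prop := ∃ φ, S.IsotopicVia S' φ

/-- Combinatorial equivalence of embedded two-complexes. -/
instance combSetoid : Setoid EmbComplex where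
  r S S' := Nonempty (TwoComplex.Iso S.K S'.K)
  iseqv := ⟨fun S => ⟨.refl S.K⟩, fun ⟨φ⟩ => ⟨φ.symm⟩, fun ⟨φ⟩ ⟨ψ⟩ => ⟨φ.trans ψ⟩⟩

end EmbComplex

/-- Ambient isotopy classes of two-complexes embedded in `S³ × [0,1]`. -/
abbrev IsotopyClass : Type := Quot EmbComplex.Isotopic

/-- Combinatorial types of two-complexes embedded in `S³ × [0,1]`. -/
abbrev CombType : Type := Quotient EmbComplex.combSetoid

/-- The combinatorial type of an isotopy class. -/
def IsotopyClass.combType : IsotopyClass → CombType :=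
  Quot.lift (fun S => ⟦S⟧) fun _ _ ⟨φ, _⟩ => Quotient.sound ⟨φ⟩

/-! ### Spin foams and topspin foams -/

/-- A spin foam `(Σ, ρ̃, ι̃)` in `S³ × [0,1]`. The spin networks `(Γ, ρ, ι)` and `(Γ', ρ', ι')` that
it connects are its restrictions to the two ends, so they are not separate data. -/
structure SpinFoam (G : Type u) [Group G] [TopologicalSpace G] where
  S : EmbComplex
  lab : Labeling G S.K.incidence

/-- Ambient isotopy of spin foams: an ambient isotopy that matches all labels. -/
def SpinFoam.Isotopic {G : Type u} [Group G] [TopologicalSpace G] (F F' : SpinFoam G) : Prop :=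
  ∃ φ : TwoComplex.Iso F.S.K F'.S.K, F.S.IsotopicVia F'.S φ ∧ F.lab = F'.lab.pull φ.hom

/-- Ambient isotopy classes of spin foams in `S³ × [0,1]`. -/
abbrev SpinFoamClass (G : Type u) [Group G] [TopologicalSpace G] : Type u :=
  Quot (SpinFoam.Isotopic (G := G))

/-- The isotopy class of the two-complex of a spin foam. -/
def SpinFoamClass.complex {G : Type u} [Group G] [TopologicalSpace G] :
    SpinFoamClass G → IsotopyClass :=
  Quot.lift (fun F => Quot.mk _ F.S) fun _ _ ⟨φ, h, _⟩ => Quot.sound ⟨φ, h⟩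

/-- The complement of `Σ` in `S³ × [0,1]`. -/
abbrev EmbComplex.Compl (S : EmbComplex) : Type := ↥(Cyl \ S.carrier)

/-- `q : W → S³ × [0,1]` is the `n`-fold PL branched covering of compact polyhedra with labeled
branch locus `(Σ, σ)`: over the complement of `Σ` it is the covering with monodromy `σ`, and `W` is
the completion of that covering (the part over the complement is dense and locally
non-disconnecting in `W`, and the fibres of `q` are finite). -/
def IsBranchedCover (S : EmbComplex) (x₀ : S.Compl) {n : ℕ}
    (σ : FundamentalGroup S.Compl x₀ →* Equiv.Perm (Fin n))
    {N : ℕ} (W : Set (Fin N → ℝ)) (q : (Fin N → ℝ) → Ambient) : Prop :=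
  PL.IsPLOn q W ∧ Set.MapsTo q W Cyl ∧
  (let U : Set (Fin N → ℝ) := {w | w ∈ W ∧ q w ∉ S.carrier}
   (∃ p : U → S.Compl, (∀ w, (p w : Ambient) = q w) ∧
      ∃ cov : IsCoveringMap p, ∃ β : Fin n ≃ p ⁻¹' {x₀},
        ∀ (γ : FundamentalGroup S.Compl x₀) (i : Fin n),
          cov.monodromy γ.toPath (β i) = β (σ γ i)) ∧
   W ⊆ closure U ∧
   (∀ w ∈ W, ∀ A ∈ 𝓝[W] w, ∃ B ∈ 𝓝[W] w, B ⊆ A ∧ IsConnected (B ∩ U)) ∧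
   ∀ x, (W ∩ q ⁻¹' {x}).Finite)

/-- A topspin foam `(Σ, ρ̃, ι̃, σ̃)`: a spin foam in `S³ × [0,1]` with a representation `σ̃` of the
fundamental group of the complement of `Σ` in a symmetric group, such that the corresponding
branched cover `W` is a four-manifold. -/
structure TopspinFoam (G : Type u) [Group G] [TopologicalSpace G] extends SpinFoam G where
  x₀ : S.Compl
  n : ℕ
  n_pos : 0 < n
  σ : FundamentalGroup S.Compl x₀ →* Equiv.Perm (Fin n)
  manifold : ∃ (N : ℕ) (W : Set (Fin N → ℝ)) (q : (Fin N → ℝ) → Ambient),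
    IsBranchedCover S x₀ σ W q ∧ PL.IsFourManifold W

/-- `(Σ, σ̃)` and `(Σ', σ̃')` determine the same PL four-manifold. -/
def TopspinFoam.Equivalent {G : Type u} [Group G] [TopologicalSpace G] (Ψ Ψ' : TopspinFoam G) :
    Prop :=
  ∃ (N : ℕ) (W : Set (Fin N → ℝ)) (q q' : (Fin N → ℝ) → Ambient), PL.IsFourManifold W ∧
    IsBranchedCover Ψ.S Ψ.x₀ Ψ.σ W q ∧ IsBranchedCover Ψ'.S Ψ'.x₀ Ψ'.σ W q'

/-! ### Amplitudes -/

/-- The amplitudes `A_f(ρ_f)`, `A_e(ρ_{F(e)}, ι_e)`, `A_v(ρ_{F(v)}, ι_{E(v)})` of the faces, edges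
and vertices of two-complexes. -/
structure CellAmplitudes (G : Type u) [Group G] [TopologicalSpace G] where
  face : ∀ K : TwoComplex, K.Face → FinRep G → ℝ
  edge : ∀ (K : TwoComplex) (e : K.Edge), Labeling G (K.edgeStar e) → ℝ
  vertex : ∀ (K : TwoComplex) (v : Fin K.n), Labeling G (K.vertexStar v) → ℝ

/-- The combinatorial part `∏_f A_f ∏_e A_e ∏_v A_v` of the amplitude. -/
def CellAmplitudes.comb {G : Type u} [Group G] [TopologicalSpace G] (A : CellAmplitudes G)
    (K : TwoComplex) (L : Labeling G K.incidence) : ℝ :=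
  (∏ f : K.Face, A.face K f (L.ρ f)) * (∏ e : K.Edge, A.edge K e (L.pull (K.edgeStarHom e))) *
    ∏ v : Fin K.n, A.vertex K v (L.pull (K.vertexStarHom v))

/-- A spin foam model: the labels it admits (for instance all labels, or only irreducible
representations and fixed bases of intertwiners) and its cell amplitudes. Both depend only on the
combinatorial structure of the labeled complex. -/
structure SpinFoamModel (G : Type u) [Group G] [TopologicalSpace G] extends CellAmplitudes G where
  adm : ∀ K : TwoComplex, Set (Labeling G K.incidence)
  adm_pull : ∀ {K K' : TwoComplex} (φ : TwoComplex.Iso K K') (L : Labeling G K'.incidence),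
    L.pull φ.hom ∈ adm K ↔ L ∈ adm K'
  comb_pull : ∀ {K K' : TwoComplex} (φ : TwoComplex.Iso K K') (L : Labeling G K'.incidence),
    toCellAmplitudes.comb K (L.pull φ.hom) = toCellAmplitudes.comb K' L

namespace SpinFoamModel

variable {G : Type u} [Group G] [TopologicalSpace G] (M : SpinFoamModel G)

/-- The combinatorial part of the amplitude of a spin foam. -/
def combAmplitude : SpinFoamClass G → ℝ :=
  Quot.lift (fun F => M.comb F.S.K F.lab) fun F F' ⟨φ, _, h⟩ => by
    simp only [h, M.comb_pull]

/-- The amplitude `A(Ψ) = ω(Σ) ∏_f A_f ∏_e A_e ∏_v A_v` of a spin foam. -/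
def amplitude (ω : IsotopyClass → ℝ) (c : SpinFoamClass G) : ℝ :=
  ω c.complex * M.combAmplitude c

/-- The equivalence class of `Ψ`: the spin foams of the model, up to ambient isotopy, that carry a
topological label making them topspin foams equivalent to `Ψ`. Topspin foams equivalent to `Ψ` that
differ only in the topological label give the same element. -/
def equivClass (Ψ : TopspinFoam G) : Set (SpinFoamClass G) :=
  {c | ∃ Ψ' : TopspinFoam G, Ψ'.lab ∈ M.adm Ψ'.S.K ∧ Ψ'.Equivalent Ψ ∧
    Quot.mk _ Ψ'.toSpinFoam = c}

end SpinFoamModel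

/-! ### The groupoid time evolution and its generator -/

section Dynamics

variable {C : Type u}

/-- The time evolution `σ_t(f)(Ψ, Ψ') = (A(Ψ) / A(Ψ'))^{it} f(Ψ, Ψ')` on finitely supported functions
on pairs of equivalent elements. -/
def timeEvolution (A : C → ℝ) (t : ℝ) (f : C × C →₀ ℂ) : C × C →₀ ℂ :=
  Finsupp.onFinset f.support
    (fun p => ((A p.1 / A p.2 : ℝ) : ℂ) ^ (Complex.I * t) * f p) fun p hp => by
      rw [Finsupp.mem_support_iff]
      exact right_ne_zero_of_mul hp

open Classical in
/-- The representation `(π(f) ξ)(Ψ) = ∑_{Ψ''} f(Ψ, Ψ'') ξ(Ψ'')`. -/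
def groupoidRep (f : C × C →₀ ℂ) (ξ : C → ℂ) (a : C) : ℂ :=
  ∑ b ∈ f.support.image Prod.snd, f (a, b) * ξ b

/-- The Hilbert space `ℓ²(C)`. -/
abbrev HilbertOf (C : Type u) : Type u := lp (fun _ : C => ℂ) 2

/-- The operator of multiplication by `g` on `ℓ²(C)`, with its maximal domain. -/
def mulOp (g : C → ℂ) : HilbertOf C →ₗ.[ℂ] HilbertOf C where
  domain :=
    { carrier := {ξ | Memℓp (fun a => g a * ξ a) 2}
      add_mem' := fun {ξ η} hξ hη => by
        have h : (fun a => g a * (ξ + η) a) = (fun a => g a * ξ a) + fun a => g a * η a := by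
          funext a
          simp [mul_add]
        exact (congrArg (fun k : C → ℂ => Memℓp k 2) h).mpr (Memℓp.add hξ hη)
      zero_mem' := by
        have h : (fun a => g a * (0 : HilbertOf C) a) = 0 := by
          funext a
          simp
        exact (congrArg (fun k : C → ℂ => Memℓp k 2) h).mpr zero_memℓp
      smul_mem' := fun c ξ hξ => by
        have h : (fun a => g a * (c • ξ) a) = c • fun a => g a * ξ a := by
          funext a
          simp [mul_left_comm]
        exact (congrArg (fun k : C → ℂ => Memℓp k 2) h).mpr (Memℓp.const_smul hξ c) }
  toFun :=
    { toFun := fun ξ => ⟨fun a => g a * ξ.1 a, ξ.2⟩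
      map_add' := fun ξ η => by
        ext a
        exact mul_add _ _ _
      map_smul' := fun c ξ => by
        ext a
        simp [mul_left_comm] }

/-- The Hamiltonian `(H ξ)(Ψ') = log A(Ψ') ξ(Ψ')`. -/
def hamiltonian (A : C → ℝ) : HilbertOf C →ₗ.[ℂ] HilbertOf C :=
  mulOp fun a => (Real.log (A a) : ℂ)

/-- The function `e^{zH}` of the Hamiltonian, which is the multiplication operator
`hamiltonian A` by `log A`: multiplication by `e^{z log A}`. -/
def expHamiltonian (A : C → ℝ) (z : ℂ) : HilbertOf C →ₗ.[ℂ] HilbertOf C :=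
  mulOp fun a => Complex.exp (z * (Real.log (A a) : ℂ))

/-- The Hamiltonian generates the time evolution: `π(σ_t(f)) e^{itH} = e^{itH} π(f)`. -/
theorem hamiltonian_generates (A : C → ℝ) (hA : ∀ a, 0 < A a) (t : ℝ) (f : C × C →₀ ℂ)
    (ξ : (expHamiltonian A (Complex.I * t)).domain) (a : C) :
    groupoidRep (timeEvolution A t f) (expHamiltonian A (Complex.I * t) ξ) a =
      Complex.exp (Complex.I * t * (Real.log (A a) : ℂ)) * groupoidRep f (ξ : HilbertOf C) a := by
  classical
  have hsub : (timeEvolution A t f).support.image Prod.snd ⊆ f.support.image Prod.snd :=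
    Finset.image_subset_image Finsupp.support_onFinset_subset
  have key : ∀ b, ((A a / A b : ℝ) : ℂ) ^ (Complex.I * t) *
      Complex.exp (Complex.I * t * (Real.log (A b) : ℂ)) =
      Complex.exp (Complex.I * t * (Real.log (A a) : ℂ)) := by
    intro b
    have hne : ((A a / A b : ℝ) : ℂ) ≠ 0 :=
      Complex.ofReal_ne_zero.2 (div_pos (hA a) (hA b)).ne'
    rw [Complex.cpow_def_of_ne_zero hne, ← Complex.ofReal_log (div_pos (hA a) (hA b)).le,
      Real.log_div (hA a).ne' (hA b).ne', ← Complex.exp_add]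
    congr 1
    push_cast
    ring
  unfold groupoidRep
  rw [Finset.sum_subset hsub, Finset.mul_sum]
  · refine Finset.sum_congr rfl fun b _ => ?_
    change ((A a / A b : ℝ) : ℂ) ^ (Complex.I * t) * f (a, b) *
      (Complex.exp (Complex.I * t * (Real.log (A b) : ℂ)) * (ξ : HilbertOf C) b) = _
    rw [← key b]
    ring
  · intro b _ hb
    have : timeEvolution A t f (a, b) = 0 := by
      by_contra h
      exact hb (Finset.mem_image.2 ⟨(a, b), Finsupp.mem_support_iff.2 h, rfl⟩)
    rw [this, zero_mul]

/-- `Tr(T) < ∞`: the operator `T` is everywhere defined, and the sum `∑_i ⟨b_i, T b_i⟩` converges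
absolutely for every orthonormal basis `b`. -/
def FiniteTrace {E : Type u} [NormedAddCommGroup E] [InnerProductSpace ℂ E]
    (T : E →ₗ.[ℂ] E) : Prop :=
  ∃ h : T.domain = ⊤, ∀ (J : Type u) (b : HilbertBasis J ℂ E),
    Summable fun i => ⟪b i, T ⟨b i, h ▸ Submodule.mem_top⟩⟫_ℂ

end Dynamics

/-! ### The growth hypotheses -/

/-- The values `α(n)` are positive and grow exponentially. -/
def ExpGrowth (α : ℕ → ℝ) : Prop :=
  (∀ n, 0 < α n) ∧
    ∃ c > (0 : ℝ), ∃ B > (0 : ℝ), ∀ᶠ n : ℕ in atTop, B * Real.exp (c * n) ≤ α n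

/-- The weight factor `ω`, an ambient isotopy invariant of embedded two-complexes, has values
`α(n)` growing exponentially, and each `α(n)` is the value of finitely many, at most `B e^{κ n}`,
isotopy classes of any given combinatorial type, where `B` and `κ` do not depend on the type. -/
def WeightHyp (ω : IsotopyClass → ℝ) : Prop :=
  ∃ α : ℕ → ℝ, ExpGrowth α ∧ (∀ s, ∃ n, ω s = α n) ∧
    ∃ κ > (0 : ℝ), ∃ B : ℝ, ∀ (t : CombType) (n : ℕ),
      {s : IsotopyClass | s.combType = t ∧ ω s = α n}.Finite ∧
      ({s : IsotopyClass | s.combType = t ∧ ω s = α n}.ncard : ℝ) ≤ B * Real.exp (κ * n)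

/-- The combinatorial amplitudes of the spin foams of the model have values `A_m` growing
exponentially, and each `A_m` is the value of finitely many, at most `B e^{lam m}`, labeled
complexes `(Σ, ρ̃, ι̃)`, where `Σ` runs over the combinatorial types of embedded two-complexes. -/
def CombHyp {G : Type u} [Group G] [TopologicalSpace G] (M : SpinFoamModel G) : Prop :=
  ∃ A : ℕ → ℝ, ExpGrowth A ∧
    (∀ (S : EmbComplex), ∀ L ∈ M.adm S.K, ∃ m, M.comb S.K L = A m) ∧
    ∃ lam > (0 : ℝ), ∃ B : ℝ, ∀ m : ℕ,
      {x : Σ t : CombType, Labeling G t.out.K.incidence |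
        x.2 ∈ M.adm x.1.out.K ∧ M.comb x.1.out.K x.2 = A m}.Finite ∧
      ({x : Σ t : CombType, Labeling G t.out.K.incidence |
        x.2 ∈ M.adm x.1.out.K ∧ M.comb x.1.out.K x.2 = A m}.ncard : ℝ) ≤ B * Real.exp (lam * m)

end

/-! ### Functoriality of pulling back labelings -/

section Pull

variable {G : Type u} [Group G] [TopologicalSpace G]

/-! The operator $e^{-\beta\mathbb H}$ is diagonal in the standard basis of $\ell^2(\mathcal
C_\Psi)$ with positive entries $\mathbb A(\Psi')^{-\beta}$, so the claim reduces to convergence of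
the zeta function $\sum_{\Psi'}\mathbb A(\Psi')^{-\beta}$ (`finiteTrace_mulOp`).

An admissible spin foam class can be described by a labeled combinatorial type $x$ together with an
isotopy class $s$ of embedded complexes of that type. The description need not be unique, since a
self-isotopy may permute labels, but one can be chosen for each class
(`SpinFoamModel.LabeledClass.exists_of_mem`), and distinct classes get distinct descriptions.
Because $\mathbb A=\omega(s)\,\mathbb A_{\rm comb}(x)$, the zeta function is at most $\sum_x\mathbb
A_{\rm comb}(x)^{-\beta}\sum_{s}\omega(s)^{-\beta}$, where $s$ runs over the isotopy classes of the
type of $x$.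

Each of the two sums is dominated by $\sum_n Be^{\kappa n}\alpha(n)^{-\beta}$, which is eventually
bounded by a geometric series of ratio $e^{\kappa-\beta c}$ and so converges for $\beta>\kappa/c$
(`ExpGrowth.exists_summable`). The multiplicity bound for $\omega$ is uniform in the combinatorial
type, so the inner sum is bounded by a constant independent of $x$, and the outer sum then converges
by the bound on labeled types. The double sum covers all admissible spin foams, so $\beta_0$ does
not depend on $\Psi$. -/

theorem Intertwiner.reindex_refl {J J' : Type} {ρ : J → FinRep G} {ρ' : J' → FinRep G}
    (T : Intertwiner ρ ρ') : T.reindex (Equiv.refl J) (Equiv.refl J') = T := by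
  apply Subtype.ext
  apply PiTensorProduct.ext
  ext x
  change (PiTensorProduct.reindex ℂ (fun j => (ρ' j).V) (Equiv.refl J'))
    (T.1 ((PiTensorProduct.reindex ℂ (fun j => (ρ j).V) (Equiv.refl J)).symm
      (PiTensorProduct.tprod ℂ x))) = T.1 (PiTensorProduct.tprod ℂ x)
  rw [PiTensorProduct.reindex_refl, PiTensorProduct.reindex_refl]
  rfl

/-- On a pure tensor both sides relabel the family of factors by `b` after `b'`; linearity does the
rest. -/
theorem PiTensorProduct.reindex_symm_reindex_symm {J J₀ J₁ : Type} (V : J → Type)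
    [∀ j, AddCommGroup (V j)] [∀ j, Module ℂ (V j)] (b : J₀ ≃ J) (b' : J₁ ≃ J₀)
    (y : ⨂[ℂ] j, V j) :
    PiTensorProduct.reindex ℂ (fun j => V (b j)) b'.symm
      (PiTensorProduct.reindex ℂ V b.symm y) =
    PiTensorProduct.reindex ℂ V (b'.trans b).symm y := by
  induction y using PiTensorProduct.induction_on with
  | smul_tprod r x =>
    simp only [map_smul]
    congr 1
    have h1 := PiTensorProduct.reindex_tprod (R := ℂ) (s := V) b.symm x
    have h2 := PiTensorProduct.reindex_tprod (R := ℂ) (s := V) (b'.trans b).symm x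
    have h3 := PiTensorProduct.reindex_tprod (R := ℂ) (s := fun j => V (b j)) b'.symm
      (fun i => x (b i))
    exact (congrArg _ h1).trans (h3.trans h2.symm)
  | add x y hx hy =>
    simp only [map_add]
    exact congrArg₂ (· + ·) hx hy

theorem Intertwiner.reindex_reindex {J J' J₀ J₀' J₁ J₁' : Type} {ρ : J → FinRep G}
    {ρ' : J' → FinRep G} (T : Intertwiner ρ ρ') (a : J₀ ≃ J) (b : J₀' ≃ J') (a' : J₁ ≃ J₀)
    (b' : J₁' ≃ J₀') :
    (T.reindex a b).reindex a' b' = T.reindex (a'.trans a) (b'.trans b) := by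
  apply Subtype.ext
  refine LinearMap.ext fun y => ?_
  change PiTensorProduct.reindex ℂ (fun j => (ρ' (b j)).V) b'.symm
      (PiTensorProduct.reindex ℂ (fun j => (ρ' j).V) b.symm
        (T.1 ((PiTensorProduct.reindex ℂ (fun j => (ρ j).V) a.symm).symm
          ((PiTensorProduct.reindex ℂ (fun j => (ρ (a j)).V) a'.symm).symm y)))) =
    PiTensorProduct.reindex ℂ (fun j => (ρ' j).V) (b'.trans b).symm
      (T.1 ((PiTensorProduct.reindex ℂ (fun j => (ρ j).V) (a'.trans a).symm).symm y))
  have hb := PiTensorProduct.reindex_symm_reindex_symm (fun j => (ρ' j).V) b b'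
    (T.1 ((PiTensorProduct.reindex ℂ (fun j => (ρ j).V) a.symm).symm
          ((PiTensorProduct.reindex ℂ (fun j => (ρ (a j)).V) a'.symm).symm y)))
  refine hb.trans (congrArg _ (congrArg _ ?_))
  have ha := PiTensorProduct.reindex_symm_reindex_symm (fun j => (ρ j).V) a a'
    ((PiTensorProduct.reindex ℂ (fun j => (ρ j).V) a.symm).symm
          ((PiTensorProduct.reindex ℂ (fun j => (ρ (a j)).V) a'.symm).symm y))
  -- On the source side the reindexings occur inverted. Moving the composite one across the equation
  -- turns this into the forward identity `ha`.
  refine ((LinearEquiv.symm_apply_eq _).2 ?_).symm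
  refine Eq.trans ?_ ha
  refine Eq.trans (LinearEquiv.apply_symm_apply _ y).symm (congrArg _ ?_)
  exact (LinearEquiv.apply_symm_apply _ _).symm

/-- The composite of maps of incidence data. -/
def IncHom.comp {I J K : Incidence} (m : IncHom J K) (m' : IncHom I J) : IncHom I K where
  onF f := m.onF (m'.onF f)
  onE e := m.onE (m'.onE e)
  bij e s hs := (m.bij (m'.onE e) s hs).comp (m'.bij e s hs)

/-- The type of a reindexed intertwiner depends on the bijections themselves, so bijections that
agree only pointwise give a heterogeneous equality. -/
theorem Intertwiner.reindex_heq {J J' J₀ J₀' : Type} {ρ : J → FinRep G} {ρ' : J' → FinRep G}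
    (T : Intertwiner ρ ρ') {a c : J₀ ≃ J} {b d : J₀' ≃ J'} (ha : ∀ j, a j = c j)
    (hb : ∀ j, b j = d j) : HEq (T.reindex a b) (T.reindex c d) := by
  obtain rfl : a = c := Equiv.ext ha
  obtain rfl : b = d := Equiv.ext hb
  rfl

theorem Labeling.pull_pull {I J K : Incidence} (L : Labeling G K) (m : IncHom J K)
    (m' : IncHom I J) : (L.pull m).pull m' = L.pull (m.comp m') := by
  have h : ∀ e, ((L.pull m).pull m').ι e = (L.pull (m.comp m')).ι e := fun e => by
    refine (Intertwiner.reindex_reindex (L.ι (m.onE (m'.onE e))) (m.around _ 1 (by decide))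
      (m.around _ (-1) (by decide)) (m'.around e 1 (by decide))
      (m'.around e (-1) (by decide))).trans (eq_of_heq ?_)
    exact Intertwiner.reindex_heq (L.ι (m.onE (m'.onE e))) (fun _ => rfl) (fun _ => rfl)
  exact congrArg (Labeling.mk fun f => L.ρ (m.onF (m'.onF f))) (funext h)

theorem Labeling.pull_eq_self {I : Incidence} (L : Labeling G I) (m : IncHom I I)
    (hF : ∀ f, m.onF f = f) (hE : ∀ e, m.onE e = e) : L.pull m = L := by
  obtain ⟨onF, onE, bij⟩ := m
  -- The types of the intertwiners depend on `onF` and `onE`; substituting identity maps makes both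
  -- labelings have components of the same type.
  obtain rfl : onF = fun f => f := funext hF
  obtain rfl : onE = fun e => e := funext hE
  have h : ∀ e, (L.pull ⟨fun f => f, fun e => e, bij⟩).ι e = L.ι e := fun e => by
    refine Eq.trans (eq_of_heq ?_) (Intertwiner.reindex_refl (L.ι e))
    exact Intertwiner.reindex_heq (L.ι e) (fun _ => rfl) (fun _ => rfl)
  exact congrArg (Labeling.mk fun f => L.ρ f) (funext h)

namespace TwoComplex

theorem Iso.symm_face_face {K K' : TwoComplex} (φ : Iso K K') (f : K.Face) :
    φ.symm.face (φ.face f) = f :=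
  Subtype.ext (by
    simp only [Iso.face, Iso.symm, Cycle.map_map_aux, Equiv.symm_comp_self, Cycle.map_id_aux])

theorem Iso.symm_edge_edge {K K' : TwoComplex} (φ : Iso K K') (e : K.Edge) :
    φ.symm.edge (φ.edge e) = e :=
  Subtype.ext (Prod.ext (φ.toEquiv.symm_apply_apply _) (φ.toEquiv.symm_apply_apply _))

/-- Isotopy of spin foams compares labels by pulling back. This identity allows labels to be pushed
forward as well, by pulling back along the inverse. -/
theorem Iso.pull_symm_pull {K K' : TwoComplex} (φ : Iso K K') (L : Labeling G K.incidence) :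
    (L.pull φ.symm.hom).pull φ.hom = L := by
  rw [Labeling.pull_pull]
  exact L.pull_eq_self _ φ.symm_face_face fun e => Subtype.ext (φ.symm_edge_edge e.1)

end TwoComplex

end Pull

/-! ### Classification of spin foams by their two-complex and labels -/

section Classification

variable {G : Type u} [Group G] [TopologicalSpace G]

/-- Labels are transported along isotopies of two-complexes. -/
theorem SpinFoamClass.exists_lab_of_eqvGen (M : SpinFoamModel G) {S S' : EmbComplex}
    (h : Relation.EqvGen EmbComplex.Isotopic S S') :
    (∀ L ∈ M.adm S.K, ∃ L' ∈ M.adm S'.K,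
      (Quot.mk _ ⟨S, L⟩ : SpinFoamClass G) = Quot.mk _ ⟨S', L'⟩) ∧
    ∀ L' ∈ M.adm S'.K, ∃ L ∈ M.adm S.K,
      (Quot.mk _ ⟨S, L⟩ : SpinFoamClass G) = Quot.mk _ ⟨S', L'⟩ := by
  -- Equality in a `Quot` yields only a chain of isotopies and reversed isotopies. Transport in both
  -- directions is carried along so that the reversed links are covered.
  induction h with
  | rel S S' h =>
    obtain ⟨φ, h⟩ := h
    exact ⟨fun L hL => ⟨L.pull φ.symm.hom, (M.adm_pull φ.symm L).2 hL,
        Quot.sound ⟨φ, h, (φ.pull_symm_pull L).symm⟩⟩,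
      fun L' hL' => ⟨L'.pull φ.hom, (M.adm_pull φ L').2 hL', Quot.sound ⟨φ, h, rfl⟩⟩⟩
  | refl S => exact ⟨fun L hL => ⟨L, hL, rfl⟩, fun L hL => ⟨L, hL, rfl⟩⟩
  | symm S S' _ ih =>
    refine ⟨fun L hL => ?_, fun L hL => ?_⟩
    · obtain ⟨L', hL', h⟩ := ih.2 L hL
      exact ⟨L', hL', h.symm⟩
    · obtain ⟨L', hL', h⟩ := ih.1 L hL
      exact ⟨L', hL', h.symm⟩
  | trans S S' S'' _ _ ih ih' =>
    refine ⟨fun L hL => ?_, fun L hL => ?_⟩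
    · obtain ⟨L', hL', h⟩ := ih.1 L hL
      obtain ⟨L'', hL'', h'⟩ := ih'.1 L' hL'
      exact ⟨L'', hL'', h.trans h'⟩
    · obtain ⟨L', hL', h⟩ := ih'.2 L hL
      obtain ⟨L'', hL'', h'⟩ := ih.2 L' hL'
      exact ⟨L'', hL'', h'.trans h⟩

theorem IsotopyClass.nonempty_iso_out (s : IsotopyClass) {t : CombType} (h : s.combType = t) :
    Nonempty (TwoComplex.Iso s.out.K t.out.K) := by
  have hs : (⟦s.out⟧ : CombType) = s.combType := congrArg IsotopyClass.combType (Quot.out_eq s)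
  exact Quotient.exact ((hs.trans h).trans t.out_eq.symm)

/-- The admissible labeled combinatorial types of embedded two-complexes. -/
abbrev SpinFoamModel.LabeledType (M : SpinFoamModel G) : Type u :=
  {x : Σ t : CombType, Labeling G t.out.K.incidence // x.2 ∈ M.adm x.1.out.K}

/-- An isotopy class of two-complexes together with an admissible labeling of its combinatorial
type. -/
abbrev SpinFoamModel.LabeledClass (M : SpinFoamModel G) : Type u :=
  Σ x : M.LabeledType, {s : IsotopyClass // s.combType = x.1.1}

/-- The spin foam whose two-complex is the chosen representative of an isotopy class, with the
labels taken from the chosen representative of its combinatorial type. -/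
noncomputable def SpinFoamModel.LabeledClass.toSpinFoam {M : SpinFoamModel G}
    (z : M.LabeledClass) : SpinFoam G :=
  ⟨z.2.1.out, z.1.1.2.pull (z.2.1.nonempty_iso_out z.2.2).some.hom⟩

/-- Move the labels along an isotopy to the chosen representative of the isotopy class, then along a
combinatorial equivalence to the chosen representative of the type. Both moves preserve
admissibility and the combinatorial amplitude. -/
theorem SpinFoamModel.LabeledClass.exists_of_mem (M : SpinFoamModel G) (F : SpinFoam G)
    (hF : F.lab ∈ M.adm F.S.K) :
    ∃ z : M.LabeledClass, (Quot.mk _ z.toSpinFoam : SpinFoamClass G) = Quot.mk _ F ∧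
      z.2.1 = SpinFoamClass.complex (Quot.mk _ F) ∧
      M.comb z.1.1.1.out.K z.1.1.2 = M.combAmplitude (Quot.mk _ F) := by
  obtain ⟨S, L⟩ := F
  obtain ⟨s, hs⟩ : ∃ s : IsotopyClass, s = Quot.mk _ S := ⟨_, rfl⟩
  obtain ⟨L', hL', h⟩ := (SpinFoamClass.exists_lab_of_eqvGen M
    (Quot.eqvGen_exact (hs.symm.trans (Quot.out_eq s).symm))).1 L hF
  obtain ⟨φ, hφ⟩ : ∃ φ, φ = (s.nonempty_iso_out rfl).some := ⟨_, rfl⟩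
  -- `φ` is the very equivalence used by `toSpinFoam`, so labeling the type by the pullback along
  -- `φ.symm` makes `toSpinFoam` return `L'` exactly.
  refine ⟨⟨⟨⟨s.combType, L'.pull φ.symm.hom⟩, (M.adm_pull φ.symm L').2 hL'⟩, s, rfl⟩, ?_, hs, ?_⟩
  · rw [h]
    refine congrArg (fun L => (Quot.mk _ ⟨s.out, L⟩ : SpinFoamClass G)) ?_
    change (L'.pull φ.symm.hom).pull (s.nonempty_iso_out rfl).some.hom = L'
    rw [← hφ, φ.pull_symm_pull]
  · rw [h]
    exact M.comb_pull φ.symm L'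

end Classification

/-! ### Summability from counting -/

section Counting

/-- Group each finite partial sum by the value of `k`. Finiteness of the fibres is needed separately
because `ncard` of an infinite set is zero. -/
theorem summable_comp_of_ncard_fiber_le {I : Type*} (k : I → ℕ) (N u : ℕ → ℝ) (hu : ∀ j, 0 ≤ u j)
    (hfin : ∀ j, {i | k i = j}.Finite) (hN : ∀ j, ({i | k i = j}.ncard : ℝ) ≤ N j)
    (hsum : Summable fun j => N j * u j) :
    Summable (fun i => u (k i)) ∧ ∑' i, u (k i) ≤ ∑' j, N j * u j := by
  classical
  have key : ∀ s : Finset I, ∑ i ∈ s, u (k i) ≤ ∑' j, N j * u j := by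
    intro s
    rw [Finset.sum_comp u k]
    have h1 : ∀ j, (({i ∈ s | k i = j} : Finset I).card : ℝ) ≤ N j := fun j => by
      refine le_trans ?_ (hN j)
      rw [← Set.ncard_coe_finset]
      refine Nat.cast_le.2 (Set.ncard_le_ncard (fun i hi => ?_) (hfin j))
      exact (Finset.mem_filter.1 hi).2
    refine le_trans (Finset.sum_le_sum fun j _ => ?_) (hsum.sum_le_tsum (s.image k) fun j _ => ?_)
    · rw [nsmul_eq_mul]
      exact mul_le_mul_of_nonneg_right (h1 j) (hu j)
    · exact mul_nonneg ((Nat.cast_nonneg _).trans (hN j)) (hu j)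
  have hs := summable_of_sum_le (fun i => hu (k i)) key
  exact ⟨hs, hs.tsum_le_of_sum_le key⟩

theorem ExpGrowth.exists_summable {α : ℕ → ℝ} (hα : ExpGrowth α) (κ B : ℝ) :
    ∃ β₀ > (0 : ℝ), ∀ β, β₀ < β →
      Summable fun n : ℕ => B * Real.exp (κ * n) * Real.exp (-β * Real.log (α n)) := by
  obtain ⟨hpos, c, hc, b, hb, hgrow⟩ := hα
  -- The series needs `β > κ / c`; the absolute value and the added 1 serve only to make the
  -- threshold positive.
  refine ⟨|κ| / c + 1, by positivity, fun β hβ => ?_⟩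
  have hβ0 : 0 < β := lt_trans (by positivity) hβ
  have hκ : κ - β * c < 0 := by
    have h1 : |κ| / c < β := by linarith
    rw [div_lt_iff₀ hc] at h1
    linarith [le_abs_self κ]
  have hsum : Summable fun n : ℕ =>
      |B| * Real.exp (-β * Real.log b) * Real.exp (n * (κ - β * c)) :=
    (Real.summable_exp_nat_mul_iff.2 hκ).mul_left _
  refine hsum.of_norm_bounded_eventually_nat ?_
  filter_upwards [hgrow] with n hn
  -- In logarithmic form the growth bound gives $\alpha(n)^{-\beta}\le b^{-\beta}e^{-\beta cn}$, for
  -- large `n` only; the remaining finitely many terms do not affect summability.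
  have hlog : Real.log b + c * n ≤ Real.log (α n) := by
    rw [← Real.log_exp (c * n), ← Real.log_mul hb.ne' (Real.exp_pos _).ne']
    exact Real.log_le_log (by positivity) hn
  rw [norm_mul, norm_mul, Real.norm_eq_abs, Real.norm_of_nonneg (Real.exp_pos _).le,
    Real.norm_of_nonneg (Real.exp_pos _).le, mul_assoc, mul_assoc, ← Real.exp_add, ← Real.exp_add]
  refine mul_le_mul_of_nonneg_left (Real.exp_le_exp.2 ?_) (abs_nonneg B)
  nlinarith [mul_le_mul_of_nonneg_left hlog hβ0.le]

/-- A family of values in `{α n}` with exponentially bounded multiplicities has a zeta function that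
converges for large `β`, with a bound that only depends on the growth data. -/
theorem ExpGrowth.exists_zeta_bound {α : ℕ → ℝ} (hα : ExpGrowth α) (κ B : ℝ) :
    ∃ β₀ > (0 : ℝ), ∀ β, β₀ < β → ∃ K : ℝ, ∀ (I : Type*) (f : I → ℝ),
      (∀ i, ∃ n, f i = α n) →
      (∀ n, {i | f i = α n}.Finite ∧ ({i | f i = α n}.ncard : ℝ) ≤ B * Real.exp (κ * n)) →
      Summable (fun i => Real.exp (-β * Real.log (f i))) ∧
        ∑' i, Real.exp (-β * Real.log (f i)) ≤ K := by
  obtain ⟨β₀, hβ₀, h⟩ := hα.exists_summable κ B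
  refine ⟨β₀, hβ₀, fun β hβ => ⟨∑' n : ℕ, B * Real.exp (κ * n) * Real.exp (-β * Real.log (α n)), fun I f hf hcount => ?_⟩⟩
  choose k hk using hf
  -- The sequence `α` may repeat values, so `k` is a choice of index and its fibres are only
  -- contained in the level sets of `f`.
  have hsub : ∀ n, {i | k i = n} ⊆ {i | f i = α n} := by
    rintro n i rfl
    exact hk i
  have := summable_comp_of_ncard_fiber_le k _ (fun n => Real.exp (-β * Real.log (α n)))
    (fun n => (Real.exp_pos _).le) (fun n => (hcount n).1.subset (hsub n))
    (fun n => (Nat.cast_le.2 (Set.ncard_le_ncard (hsub n) (hcount n).1)).trans (hcount n).2)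
    (h β hβ)
  simpa only [hk] using this

/-- By Tonelli, sum over the fibre first; the common bound `K` leaves a series dominated by `K`
times that of `f`. -/
theorem summable_sigma_mul_of_tsum_le {X : Type*} {S : X → Type*} {f : X → ℝ} {g : ∀ x, S x → ℝ}
    {K : ℝ} (hf : ∀ x, 0 ≤ f x) (hg : ∀ x s, 0 ≤ g x s) (hfs : Summable f)
    (hgs : ∀ x, Summable (g x) ∧ ∑' s, g x s ≤ K) :
    Summable fun z : Σ x, S x => f z.1 * g z.1 z.2 := by
  refine (summable_sigma_of_nonneg fun z => mul_nonneg (hf z.1) (hg z.1 z.2)).2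
    ⟨fun x => (hgs x).1.mul_left (f x), ?_⟩
  simp only [tsum_mul_left]
  exact Summable.of_nonneg_of_le (fun x => mul_nonneg (hf x) (tsum_nonneg (hg x)))
    (fun x => mul_le_mul_of_nonneg_left (hgs x).2 (hf x)) (hfs.mul_right K)

end Counting

/-! ### Diagonal trace class operators -/

section Diagonal

variable {C : Type u}

/-- A summable `g` is bounded, and multiplication by a bounded function preserves $\ell^2$. -/
theorem mulOp_domain_eq_top {g : C → ℂ} (hg : Summable fun a => ‖g a‖) :
    (mulOp g).domain = ⊤ := by
  refine Submodule.eq_top_iff'.2 fun ξ => ?_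
  obtain ⟨R, hR⟩ : ∃ R, ∀ a, ‖g a‖ ≤ R := ⟨∑' a, ‖g a‖, fun a =>
    hg.le_tsum a fun b _ => norm_nonneg _⟩
  have hξ : Memℓp (fun a => R • ξ a) 2 := (lp.memℓp ξ).const_smul R
  refine hξ.mono' fun a => ?_
  rw [norm_mul, norm_smul]
  exact mul_le_mul_of_nonneg_right ((hR a).trans (le_abs_self R)) (norm_nonneg _)

/-- For any orthonormal basis, $\sum_i\sum_a|g(a)||b_i(a)|^2=\sum_a|g(a)|$, since Parseval for the
unit vector at $a$ gives $\sum_i|b_i(a)|^2=1$. Tonelli allows the order of summation to be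
exchanged, so the diagonal coefficients are absolutely summable. -/
theorem finiteTrace_mulOp {g : C → ℂ} (hg : Summable fun a => ‖g a‖) : FiniteTrace (mulOp g) := by
  classical
  refine ⟨mulOp_domain_eq_top hg, fun J b => ?_⟩
  have hcol : ∀ a, HasSum (fun i => ‖(b i : C → ℂ) a‖ ^ 2) 1 := by
    intro a
    have h := b.hasSum_inner_mul_inner (lp.single 2 a (1 : ℂ)) (lp.single 2 a (1 : ℂ))
    have h' := (Complex.hasSum_re h)
    simp only [lp.inner_single_left, lp.inner_single_right] at h'
    convert h' using 1
    · funext i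
      simp [Complex.normSq_apply, Complex.sq_norm]
    · simp
  have hsum : Summable fun p : C × J => ‖g p.1‖ * ‖(b p.2 : C → ℂ) p.1‖ ^ 2 := by
    refine (summable_prod_of_nonneg fun p => by positivity).2 ⟨fun a => ?_, ?_⟩
    · exact (hcol a).summable.mul_left ‖g a‖
    · simpa only [tsum_mul_left, (hcol _).tsum_eq, mul_one] using hg
  have hsum' := hsum.prod_symm.prod
  refine Summable.of_norm_bounded hsum' fun i => ?_
  have hrow := hsum.prod_symm.prod_factor i
  rw [lp.inner_eq_tsum]
  refine (norm_tsum_le_tsum_norm ?_).trans_eq (tsum_congr fun a => ?_)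
  · refine hrow.congr fun a => ?_
    change ‖g a‖ * ‖(b i : C → ℂ) a‖ ^ 2 = ‖inner ℂ ((b i : C → ℂ) a) (g a * (b i : C → ℂ) a)‖
    simp
    ring
  · change ‖inner ℂ ((b i : C → ℂ) a) (g a * (b i : C → ℂ) a)‖ = ‖g a‖ * ‖(b i : C → ℂ) a‖ ^ 2
    simp
    ring

end Diagonal

/-! ### Convergence of the zeta sums and finiteness of the trace -/

theorem Set.finite_ncard_le_subtype {X : Type*} {p q : X → Prop} {R : ℝ}
    (h : {x | p x ∧ q x}.Finite ∧ ({x | p x ∧ q x}.ncard : ℝ) ≤ R) :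
    {x : {x // p x} | q x.1}.Finite ∧ ({x : {x // p x} | q x.1}.ncard : ℝ) ≤ R := by
  have him : Subtype.val '' {x : {x // p x} | q x.1} = {x | p x ∧ q x} := by
    ext s
    simp [and_comm]
  rw [← him, Set.ncard_image_of_injective _ Subtype.val_injective] at h
  exact ⟨h.1.of_finite_image Subtype.val_injective.injOn, h.2⟩

/-- The bound `K` may depend on `β` but precedes `t`: this uniformity comes from `κ` and `B` being
the same for all types, and it is what lets the inner sum be factored out. -/
theorem WeightHyp.exists_zeta_bound {ω : IsotopyClass → ℝ} (hω : WeightHyp ω) :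
    ∃ β₀ > (0 : ℝ), ∀ β, β₀ < β → ∃ K : ℝ, ∀ t : CombType,
      (Summable fun s : {s : IsotopyClass // s.combType = t} =>
        Real.exp (-β * Real.log (ω s.1))) ∧
      ∑' s : {s : IsotopyClass // s.combType = t}, Real.exp (-β * Real.log (ω s.1)) ≤ K := by
  obtain ⟨α, hα, hωα, κ, -, B, hcount⟩ := hω
  obtain ⟨β₀, hβ₀, h⟩ := hα.exists_zeta_bound κ B
  refine ⟨β₀, hβ₀, fun β hβ => ?_⟩
  obtain ⟨K, hK⟩ := h β hβ
  exact ⟨K, fun t => hK {s : IsotopyClass // s.combType = t} (fun s => ω s.1) (fun s => hωα s.1)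
    fun n => Set.finite_ncard_le_subtype (hcount t n)⟩

theorem CombHyp.exists_summable {G : Type u} [Group G] [TopologicalSpace G]
    {M : SpinFoamModel G} (hM : CombHyp M) :
    ∃ β₀ > (0 : ℝ), ∀ β, β₀ < β → Summable fun x : M.LabeledType =>
      Real.exp (-β * Real.log (M.comb x.1.1.out.K x.1.2)) := by
  obtain ⟨A, hA, hMA, lam, -, B, hcount⟩ := hM
  obtain ⟨β₀, hβ₀, h⟩ := hA.exists_zeta_bound lam B
  refine ⟨β₀, hβ₀, fun β hβ => ?_⟩
  obtain ⟨K, hK⟩ := h β hβ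
  exact (hK M.LabeledType (fun x => M.comb x.1.1.out.K x.1.2) (fun x => hMA x.1.1.out x.1.2 x.2)
    fun m => Set.finite_ncard_le_subtype (hcount m)).1

theorem SpinFoamModel.summable_labeledClass {G : Type u} [Group G] [TopologicalSpace G]
    (M : SpinFoamModel G) {ω : IsotopyClass → ℝ} (hω : WeightHyp ω) (hM : CombHyp M) :
    ∃ β₀ > (0 : ℝ), ∀ β, β₀ < β → Summable fun z : M.LabeledClass =>
      Real.exp (-β * Real.log (M.comb z.1.1.1.out.K z.1.1.2)) *
        Real.exp (-β * Real.log (ω z.2.1)) := by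
  obtain ⟨β₁, hβ₁, h₁⟩ := hω.exists_zeta_bound
  obtain ⟨β₂, hβ₂, h₂⟩ := hM.exists_summable
  refine ⟨max β₁ β₂, lt_max_of_lt_left hβ₁, fun β hβ => ?_⟩
  obtain ⟨K, hK⟩ := h₁ β ((le_max_left _ _).trans_lt hβ)
  exact summable_sigma_mul_of_tsum_le (X := M.LabeledType)
    (S := fun x => {s : IsotopyClass // s.combType = x.1.1})
    (f := fun x => Real.exp (-β * Real.log (M.comb x.1.1.out.K x.1.2)))
    (g := fun x s => Real.exp (-β * Real.log (ω s.1)))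
    (fun x => (Real.exp_pos _).le) (fun x s => (Real.exp_pos _).le)
    (h₂ β ((le_max_right _ _).trans_lt hβ)) fun x => hK x.1.1

theorem mainTheorem9 {𝔤 : Type*} [NormedAddCommGroup 𝔤] [NormedSpace ℝ 𝔤] [FiniteDimensional ℝ 𝔤]
    (G : Type u) [Group G] [TopologicalSpace G] [ChartedSpace 𝔤 G]
    [LieGroup (modelWithCornersSelf ℝ 𝔤) ((⊤ : ℕ∞) : WithTop ℕ∞) G] [CompactSpace G] [T2Space G]
    (M : SpinFoamModel G) (ω : IsotopyClass → ℝ) (hω : WeightHyp ω) (hM : CombHyp M) :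
    ∃ β₀ > (0 : ℝ), ∀ (Ψ : TopspinFoam G) (β : ℝ), β₀ < β →
      FiniteTrace (expHamiltonian (fun c : M.equivClass Ψ => M.amplitude ω c) (-(β : ℂ))) := by
  obtain ⟨β₀, hβ₀, h⟩ := M.summable_labeledClass hω hM
  refine ⟨β₀, hβ₀, fun Ψ β hβ => finiteTrace_mulOp ?_⟩
  have hex : ∀ c : M.equivClass Ψ, ∃ z : M.LabeledClass, (Quot.mk _ z.toSpinFoam : SpinFoamClass G) = c.1 ∧
      z.2.1 = c.1.complex ∧ M.comb z.1.1.1.out.K z.1.1.2 = M.combAmplitude c.1 := by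
    rintro ⟨_, Ψ', hadm, -, rfl⟩
    exact SpinFoamModel.LabeledClass.exists_of_mem M Ψ'.toSpinFoam hadm
  choose z hz hzω hzA using hex
  -- The class is recovered from its chosen description by `toSpinFoam`, so the choice is injective
  -- and the sum over the equivalence class is a subsum of the double sum.
  have hinj : Function.Injective z := fun c c' hcc => Subtype.ext (by rw [← hz c, ← hz c', hcc])
  refine ((h β hβ).comp_injective hinj).congr fun c => ?_
  -- Both factors are nonzero because they occur among the positive values in the growth hypotheses,
  -- so the logarithm of the amplitude splits as a sum.
  obtain ⟨α, hα, hωα, -⟩ := hω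
  obtain ⟨A, hA, hMA, -⟩ := hM
  have hω0 : ω c.1.complex ≠ 0 := by
    obtain ⟨n, hn⟩ := hωα c.1.complex
    exact hn ▸ (hα.1 n).ne'
  have hM0 : M.combAmplitude c.1 ≠ 0 := by
    obtain ⟨m, hm⟩ := hMA (z c).1.1.1.out (z c).1.1.2 (z c).1.2
    rw [← hzA c, hm]
    exact (hA.1 m).ne'
  have hamp : M.amplitude ω c.1 = ω c.1.complex * M.combAmplitude c.1 := rfl
  beta_reduce
  rw [Function.comp_apply, hzA c, hzω c, ← Real.exp_add, Complex.norm_exp, hamp,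
    Real.log_mul hω0 hM0]
  congr 1
  rw [← Complex.ofReal_neg, ← Complex.ofReal_mul, Complex.ofReal_re]
  ring
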